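/- An economy consists of a finite set $I$ of agents, a finite set $O$ of objects, a null object $o^*$, for every agent $i$ a strict linear order $\succ_i$ on $O\cup\{o^*\}$ (with $\succsim_i$ its weak version), and for every object $o$ a nonempty set $C_o\subseteq I$ of owners. It is a private-ownership economy if $|C_o|=1$ for every $o\in O$. An allocation is a map $\mu:I\to O\cup\{o^*\}$ that assigns no $o\in O$ to two agents. For $C\subseteq I$ put $\omega(C)=\{o: C_o\subseteq C\}$. A coalition is a nonempty set of agents; a coalition $C$ is self-enforcing in $\sigma$ if $\sigma(C)\subseteq\omega(C)\cup\{o^*\}$, and minimal self-enforcing if moreover no nonempty proper subset of $C$ is self-enforcing in $\sigma$. Put $C_{\sigma=\mu}=\{i\in C:\sigma(i)=\mu(i)\}$ and $\Omega(C\mid\omega,\mu)=\omega(\bigcup_{k\ge0}C^k)$, where $C^0=C$ and $C^{k}=C^{k-1}\cup\mu^{-1}(\omega(C^{k-1}))$. Say that $C$ improves from $\mu$ to $\sigma$ if $\sigma(i)\succsim_i\mu(i)$ for all $i\in C$ and $\sigma(j)\succ_j\mu(j)$ for some $j\in C$. The strong core, rectified core, exclusion core and refined exclusion core are the sets of allocations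 $\mu$ that no coalition $C$ blocks via any allocation $\sigma$ in the respective sense: - weak blocking (strong core): $C$ improves and is self-enforcing in $\sigma$; - rectification blocking (rectified core): $C$ weakly blocks, and for every coalition $C'\subseteq C_{\sigma=\mu}$ that is self-enforcing in $\sigma$ and every $i\in C\setminus C'$, $\sigma(i)\in\omega(C')$ implies $\sigma(i)\notin\mu(I\setminus C)$; - exclusion blocking (exclusion core): $\sigma(i)\succ_i\mu(i)$ for all $i\in C$, and for all $j\in I$, $\mu(j)\succ_j\sigma(j)$ implies $\mu(j)\in\Omega(C\mid\omega,\mu)$; - refined exclusion blocking (refined exclusion core): $C$ improves; for all $j\in I$, $\mu(j)\succ_j\sigma(j)$ implies $\mu(j)\in\Omega(C\mid\omega,\mu)$; and if $C_{\sigma=\mu}\ne\emptyset$, then either $C_{\sigma=\mu}$ is self-enforcing in $\sigma$ and for all $j\in I$, $\mu(j)\succ_j\sigma(j)$ implies $\mu(j)\notin\Omega(C_{\sigma=\mu}\mid\omega,\mu)$, or $C$ is minimal self-enforcing in $\sigma$. The YRMH-IGYT ("you request my house -- I get your turn") algorithm for a fixed linear order $\rhd$ of the agents starts with $\rhd$ as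 the current order, no shared ownership, and every object pointing to its $\rhd$-highest owner. At the start of a step, every remaining object that pointed to an agent removed in the previous step is made to point to its $\rhd$-highest remaining owner; if there is none, to the $\rhd$-highest remaining agent who shares its ownership; if there is none either, to nobody. All other arcs between remaining agents and objects are kept. Then the highest agent $i$ in the current order points to her favorite $o$ among the remaining objects and $o^*$. (i) If $o=o^*$ or $o$ points to nobody, $i$ obtains $o$, and $i$ and $o$ are removed ($o^*$ always stays available). (ii) If a cycle through $i$ forms, every agent in the cycle obtains the object she points to, and these agents and objects are removed; moreover, for every agent $j$ in the cycle, every remaining object $a$ that $j$ owns or shares, every object $b$ in the cycle and every remaining agent $j'$ who owns or shares $b$ but neither owns nor shares $a$, $j'$ from then on shares the ownership of $a$. (iii) Otherwise the agent to whom $o$ points is moved to the top of the current order. The algorithm ends when all agents are removed; the resulting assignments, over all orders $\rhd$, are the outcomes of YRMH-IGYT. Proposition. In every private-ownership economy, the set of YRMH-IGYT outcomes, the rectified core, the refined exclusion core and the exclusion core all coincide; and if the strong core is nonempty, they also coincide with the strong core. -/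

import Mathlib

namespace ComplexEndowments

/-- An economy with complex endowments: agents `I`, objects `O`; the null object is
`none : Option O`. `prefers i a b` is agent `i`'s strict preference of `a` over `b`, a strict linear
order on the objects together with the null object; `owners o` is the nonempty set of owners
of `o`. Finiteness of `I` and `O` is assumed where economies are used. -/
structure Economy (I O : Type*) where
  prefers : I → Option O → Option O → Prop
  prefers_strict : ∀ i, IsStrictTotalOrder (Option O) (prefers i)
  owners : O → Set I
  owners_nonempty : ∀ o, (owners o).Nonempty

/-- Each agent gets one object or the null object, and no object is given to two agents
(an object may be left unassigned). -/
def IsAllocation {I O : Type*} (μ : I → Option O) : Prop :=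
  ∀ (i j : I) (o : O), μ i = some o → μ j = some o → i = j

namespace Economy

variable {I O : Type*} (E : Economy I O)

/-- Every object has exactly one owner. -/
def IsPrivateOwnership : Prop := ∀ o, (E.owners o).ncard = 1

/-- `a` is at least as good as `b` for agent `i`. -/
def weaklyPrefers (i : I) (a b : Option O) : Prop := a = b ∨ E.prefers i a b

/-- The endowments of a set `C` of agents: the objects all of whose owners are in `C`. -/
def endowment (C : Set I) : Set O := {o | E.owners o ⊆ C}

/-- `C` is self-enforcing in `σ`: the objects that `σ` assigns to members of `C` are endowments
of `C`. -/
def SelfEnforcing (C : Set I) (σ : I → Option O) : Prop :=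
  ∀ i ∈ C, ∀ o, σ i = some o → o ∈ E.endowment C

/-- The coalition `C` is self-enforcing and no (nonempty, proper) sub-coalition of it is. -/
def MinimalSelfEnforcing (C : Set I) (σ : I → Option O) : Prop :=
  E.SelfEnforcing C σ ∧ ∀ C' : Set I, C'.Nonempty → C' ⊂ C → ¬ E.SelfEnforcing C' σ

/-- The unaffected members of `C`. -/
def unaffected (C : Set I) (μ σ : I → Option O) : Set I := {i ∈ C | σ i = μ i}

/-- Every member of `C` is weakly better off and some member is strictly better off. -/
def Improves (C : Set I) (μ σ : I → Option O) : Prop :=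
  (∀ i ∈ C, E.weaklyPrefers i (σ i) (μ i)) ∧ ∃ j ∈ C, E.prefers j (σ j) (μ j)

def WeaklyBlocks (C : Set I) (μ σ : I → Option O) : Prop :=
  E.Improves C μ σ ∧ E.SelfEnforcing C σ

def strongCore : Set (I → Option O) :=
  {μ | IsAllocation μ ∧
    ¬ ∃ (C : Set I) (σ : I → Option O), C.Nonempty ∧ IsAllocation σ ∧ E.WeaklyBlocks C μ σ}

/-- Rectification blocking: weak blocking such that no self-enforcing set `C'` of unaffected
members gives the other members one of its endowments that `μ` assigns outside `C`. -/
def RectificationBlocks (C : Set I) (μ σ : I → Option O) : Prop :=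
  E.Improves C μ σ ∧ E.SelfEnforcing C σ ∧
    ∀ C' : Set I, C'.Nonempty → C' ⊆ unaffected C μ σ → E.SelfEnforcing C' σ →
      ∀ i ∈ C \ C', ∀ o, σ i = some o → o ∈ E.endowment C' → ∀ k ∉ C, μ k ≠ some o

def rectifiedCore : Set (I → Option O) :=
  {μ | IsAllocation μ ∧
    ¬ ∃ (C : Set I) (σ : I → Option O), C.Nonempty ∧ IsAllocation σ ∧ E.RectificationBlocks C μ σ}

/-- `C⁰ = C`, and `Cᵏ⁺¹` adds to `Cᵏ` the agents to whom `μ` assigns an endowment of `Cᵏ`. -/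
def controlSeq (C : Set I) (μ : I → Option O) : ℕ → Set I
  | 0 => C
  | k + 1 => controlSeq C μ k ∪ {i | ∃ o ∈ E.endowment (controlSeq C μ k), μ i = some o}

/-- The objects directly or indirectly controlled by `C` in `μ`: `Ω(C | ω, μ)`. -/
def controlled (C : Set I) (μ : I → Option O) : Set O :=
  E.endowment (⋃ k, E.controlSeq C μ k)

/-- Every agent who is worse off in `σ` than in `μ` is assigned by `μ` an object in
`Ω(C | ω, μ)`. -/
def LosersControlled (C : Set I) (μ σ : I → Option O) : Prop :=
  ∀ j, E.prefers j (μ j) (σ j) → ∃ o ∈ E.controlled C μ, μ j = some o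

/-- No agent who is worse off in `σ` than in `μ` is assigned by `μ` an object in
`Ω(C | ω, μ)`. -/
def LosersNotControlled (C : Set I) (μ σ : I → Option O) : Prop :=
  ∀ j, E.prefers j (μ j) (σ j) → ¬ ∃ o ∈ E.controlled C μ, μ j = some o

def ExclusionBlocks (C : Set I) (μ σ : I → Option O) : Prop :=
  (∀ i ∈ C, E.prefers i (σ i) (μ i)) ∧ E.LosersControlled C μ σ

def exclusionCore : Set (I → Option O) :=
  {μ | IsAllocation μ ∧
    ¬ ∃ (C : Set I) (σ : I → Option O), C.Nonempty ∧ IsAllocation σ ∧ E.ExclusionBlocks C μ σ}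

def RefinedExclusionBlocks (C : Set I) (μ σ : I → Option O) : Prop :=
  E.Improves C μ σ ∧ E.LosersControlled C μ σ ∧
    ((unaffected C μ σ).Nonempty →
      (E.SelfEnforcing (unaffected C μ σ) σ ∧ E.LosersNotControlled (unaffected C μ σ) μ σ) ∨
        E.MinimalSelfEnforcing C σ)

def refinedExclusionCore : Set (I → Option O) :=
  {μ | IsAllocation μ ∧
    ¬ ∃ (C : Set I) (σ : I → Option O),
      C.Nonempty ∧ IsAllocation σ ∧ E.RefinedExclusionBlocks C μ σ}

end Economy

/-- A linear order of the agents, given by listing them from the highest to the lowest. -/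
def IsAgentOrder {I : Type*} (L : List I) : Prop := L.Nodup ∧ ∀ i, i ∈ L

/-- The member of `S` ranked highest in the order `L`, if there is one. -/
noncomputable def highest {I : Type*} (L : List I) (S : Set I) : Option I :=
  open Classical in L.find? (fun i => decide (i ∈ S))

/-- A state of the algorithm.
* `order`: the current order of the remaining agents, highest first (so `i ∈ order` says that `i`
  remains);
* `objects`: the remaining objects;
* `assigned`: the assignments of the removed agents (`none` also for the remaining agents);
* `agentArc`: the remaining arcs from remaining agents to remaining objects;
* `objectArc`: the remaining agent, if any, to whom a remaining object points;
* `shared o`: the remaining agents who have obtained shared ownership of `o`. -/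
structure YState (I O : Type*) where
  order : List I
  objects : Set O
  assigned : I → Option O
  agentArc : I → Option O
  objectArc : O → Option I
  shared : O → Set I

namespace YState

variable {I O : Type*}

/-- Nobody has been removed, and every object points to its highest-ranked owner. -/
noncomputable def init (E : Economy I O) (L : List I) : YState I O where
  order := L
  objects := Set.univ
  assigned := fun _ => none
  agentArc := fun _ => none
  objectArc := fun o => highest L (E.owners o)
  shared := fun _ => ∅

/-- The null object always remains available. -/
def Available (s : YState I O) (a : Option O) : Prop := ∀ o, a = some o → o ∈ s.objects

/-- `a` is agent `i`'s favorite among the remaining objects and the null object. -/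
def IsFavorite (E : Economy I O) (s : YState I O) (i : I) (a : Option O) : Prop :=
  s.Available a ∧ ∀ b, s.Available b → E.weaklyPrefers i a b

/-- Let `i` point to `a`. -/
noncomputable def point (s : YState I O) (i : I) (a : Option O) : YState I O :=
  open Classical in { s with agentArc := Function.update s.agentArc i a }

/-- `j` points to an object that points to `k`. -/
def Next (s : YState I O) (j k : I) : Prop :=
  ∃ o, s.agentArc j = some o ∧ s.objectArc o = some k

/-- `i` is on a cycle of the graph of current arcs. -/
def OnCycle (s : YState I O) (i : I) : Prop := Relation.TransGen s.Next i i

/-- The agents reached from `i`; if `i` is on a cycle, these are the agents on that cycle, since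
every agent and every object has at most one outgoing arc. -/
def cycle (s : YState I O) (i : I) : Set I := {j | Relation.TransGen s.Next i j}

/-- The objects to which members of `R` point. -/
def targets (s : YState I O) (R : Set I) : Set O := {o | ∃ j ∈ R, s.agentArc j = some o}

/-- The remaining owners of `o`. -/
def remainingOwners (E : Economy I O) (s : YState I O) (o : O) : Set I :=
  {i ∈ E.owners o | i ∈ s.order}

/-- The remaining owners and sharing owners of `o`. -/
def claimants (E : Economy I O) (s : YState I O) (o : O) : Set I :=
  s.remainingOwners E o ∪ s.shared o

/-- The shared ownership of `a` created when the agents `R` on a cycle are removed: it goes to every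
agent outside `R` who claims an object `b` of the cycle but does not yet claim `a`, provided that
some agent in `R` claims `a`. -/
def newSharers (E : Economy I O) (s : YState I O) (R : Set I) (a : O) : Set I :=
  {k | k ∉ R ∧ (∃ j ∈ R, j ∈ s.claimants E a) ∧ (∃ b ∈ s.targets R, k ∈ s.claimants E b) ∧
    k ∉ s.claimants E a}

/-- Every member of `R` obtains what she points to (the null object if she has no arc to an
object); the agents `R` and these objects are removed with their arcs. `new` is the additional
shared ownership. -/
noncomputable def remove (s : YState I O) (R : Set I) (new : O → Set I) : YState I O :=
  open Classical in
  { order := s.order.filter (fun i => decide (i ∉ R))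
    objects := s.objects \ s.targets R
    assigned := fun i => if i ∈ R then s.agentArc i else s.assigned i
    agentArc := fun i =>
      if i ∈ R ∨ ∃ o ∈ s.targets R, s.agentArc i = some o then none else s.agentArc i
    objectArc := s.objectArc
    shared := fun o => (s.shared o ∪ new o) \ R }

/-- Every object pointing to an agent who is no longer present is redirected to the
highest-ranked remaining owner, or, if there is none, to the highest-ranked sharing owner, or, if
there is none either, to nobody. The ranking is always the initial order `L`. -/
noncomputable def redirect (E : Economy I O) (L : List I) (s : YState I O) : YState I O :=
  open Classical in
  { s with
    objectArc := fun o =>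
      if ∃ i, s.objectArc o = some i ∧ i ∉ s.order then
        (highest L (s.remainingOwners E o)).or (highest L (s.shared o))
      else s.objectArc o }

/-- Move `j` to the top of the current order. -/
noncomputable def moveToTop (s : YState I O) (j : I) : YState I O :=
  open Classical in { s with order := j :: s.order.filter (fun i => decide (i ≠ j)) }

/-- One step. The agent `i` on top of the current order points to her favorite `a`; then
* if `a` is the null object or points to nobody, `i` obtains it and leaves;
* if a cycle forms, its agents obtain the objects they point to and leave;
* otherwise the agent to whom `a` points is moved to the top. -/
inductive Step (E : Economy I O) (L : List I) : YState I O → YState I O → Prop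
  | leave (s : YState I O) (i : I) (rest : List I) (a : Option O)
      (htop : s.order = i :: rest) (hfav : s.IsFavorite E i a)
      (hfree : ∀ o, a = some o → s.objectArc o = none) :
      Step E L s (((s.point i a).remove {i} (fun _ => ∅)).redirect E L)
  | trade (s : YState I O) (i : I) (rest : List I) (o : O)
      (htop : s.order = i :: rest) (hfav : s.IsFavorite E i (some o))
      (hcycle : (s.point i (some o)).OnCycle i) :
      Step E L s
        (((s.point i (some o)).remove ((s.point i (some o)).cycle i)
          ((s.point i (some o)).newSharers E ((s.point i (some o)).cycle i))).redirect E L)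
  | request (s : YState I O) (i : I) (rest : List I) (o : O) (j : I)
      (htop : s.order = i :: rest) (hfav : s.IsFavorite E i (some o))
      (harc : s.objectArc o = some j) (hcycle : ¬ (s.point i (some o)).OnCycle i) :
      Step E L s ((s.point i (some o)).moveToTop j)

end YState

/-- The outcomes of the mechanism: the assignments in the state reached when all agents have been
removed, for some linear order of the agents. -/
def Economy.yrmhOutcomes {I O : Type*} (E : Economy I O) : Set (I → Option O) :=
  {μ | ∃ L : List I, IsAgentOrder L ∧ ∃ s : YState I O,
    Relation.ReflTransGen (YState.Step E L) (YState.init E L) s ∧ s.order = [] ∧ s.assigned = μ}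

end ComplexEndowments

/-! ### Preferences, and rankings as certificates of stability. -/

namespace ComplexEndowments

namespace Economy

variable {I O : Type*} (E : Economy I O)

/-! All the sets are compared with one certificate, `HasRanking`: a rank for each agent, to be
thought of as a round of top trading cycles, such that the owner of a held object never ranks above
its holder and every envied object is held at a strictly smaller rank. Trading partners may share a
rank.

A ranking excludes every kind of blocking. A gainer of minimal rank takes the object of an agent of
smaller rank, while ranks never increase from a holder to the owner of her object; chasing such
chains contradicts each blocking condition (the three lemmas `IsRanking.mem_exclusionCore`,
`IsRanking.mem_refinedExclusionCore`, `IsRanking.mem_rectifiedCore`).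

Conversely, if an allocation has no ranking, a maximal ranked set of agents is stuck, and a cycle of
favorites outside it gives a single `σ` that blocks in both the exclusion and the rectification
sense (`exists_blocks_of_not_hasRanking`).

For the algorithm, batches of departing agents are the rounds of a ranking (`Ranked.step`). In the
other direction, starting from an order sorted by rank, the algorithm reproduces the ranked
allocation (`Follows.exists_step`). Finally, a ranked allocation must equal any member of the strong
core. -/

theorem prefers_irrefl (i : I) (a : Option O) : ¬ E.prefers i a a :=
  have := E.prefers_strict i
  irrefl_of (E.prefers i) a

theorem prefers_trans {i : I} {a b c : Option O} (hab : E.prefers i a b) (hbc : E.prefers i b c) :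
    E.prefers i a c :=
  have := E.prefers_strict i
  trans_of (E.prefers i) hab hbc

theorem prefers_asymm {i : I} {a b : Option O} (hab : E.prefers i a b) : ¬ E.prefers i b a :=
  fun hba => E.prefers_irrefl i a (E.prefers_trans hab hba)

theorem weaklyPrefers_of_not_prefers {i : I} {a b : Option O} (h : ¬ E.prefers i b a) :
    E.weaklyPrefers i a b := by
  have := E.prefers_strict i
  rcases trichotomous_of (E.prefers i) a b with h1 | h1 | h1
  · exact Or.inr h1
  · exact Or.inl h1
  · exact absurd h1 h

theorem not_prefers_of_weaklyPrefers {i : I} {a b : Option O} (h : E.weaklyPrefers i a b) :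
    ¬ E.prefers i b a := by
  rcases h with rfl | h
  · exact E.prefers_irrefl i a
  · exact E.prefers_asymm h

theorem exists_favorite [Finite O] (i : I) (T : Set (Option O)) (hT : T.Nonempty) :
    ∃ a ∈ T, ∀ b ∈ T, ¬ E.prefers i b a := by
  have := E.prefers_strict i
  exact (Finite.wellFounded_of_trans_of_irrefl (E.prefers i)).has_min T hT

theorem IsPrivateOwnership.exists_owner {E : Economy I O} (hE : E.IsPrivateOwnership) :
    ∃ w : O → I, ∀ o, E.owners o = {w o} := by
  choose w hw using fun o => Set.ncard_eq_one.1 (hE o)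
  exact ⟨w, hw⟩

/-- `r` ranks the members of `S` such that `S` is self-enforcing in `μ`, the owner of the object of a
member of `S` does not rank below her, and everything that a member of `S` prefers to her assignment
is assigned to a member of `S` with smaller rank. -/
structure IsRanking (μ : I → Option O) (S : Set I) (r : I → ℕ) : Prop where
  inj : ∀ i ∈ S, ∀ j ∈ S, ∀ o, μ i = some o → μ j = some o → i = j
  owner_mem : ∀ i ∈ S, ∀ o, μ i = some o → ∀ k ∈ E.owners o, k ∈ S
  owner_le : ∀ i ∈ S, ∀ o, μ i = some o → ∀ k ∈ E.owners o, r k ≤ r i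
  better_lt : ∀ i ∈ S, ∀ b, E.prefers i b (μ i) → ∃ o, b = some o ∧ ∃ j ∈ S, μ j = some o ∧ r j < r i

def HasRanking (μ : I → Option O) (S : Set I) : Prop := ∃ r, E.IsRanking μ S r

theorem hasRanking_empty (μ : I → Option O) : E.HasRanking μ ∅ :=
  ⟨fun _ => 0, by simp, by simp, by simp, by simp⟩

variable {E}

theorem HasRanking.union [Finite I] {μ ν : I → Option O} {S R : Set I} (h : E.HasRanking μ S)
    (hagree : ∀ i ∈ S, ν i = μ i)
    (hinj : ∀ i ∈ R, ∀ j ∈ R, ∀ o, ν i = some o → ν j = some o → i = j)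
    (hfresh : ∀ i ∈ R, ∀ j ∈ S, ∀ o, ν i = some o → μ j ≠ some o)
    (howner : ∀ i ∈ R, ∀ o, ν i = some o → ∀ k ∈ E.owners o, k ∈ S ∪ R)
    (hbetter : ∀ i ∈ R, ∀ b, E.prefers i b (ν i) → ∃ o, b = some o ∧ ∃ j ∈ S, μ j = some o) :
    E.HasRanking ν (S ∪ R) := by
  classical
  obtain ⟨r, hr⟩ := h
  obtain ⟨B, hB⟩ := (Set.finite_range r).bddAbove
  have hB' : ∀ i, r i ≤ B := fun i => hB ⟨i, rfl⟩
  have hRS : ∀ i ∈ S ∪ R, i ∉ S → i ∈ R := fun i hi h => hi.resolve_left h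
  -- All new members share one rank above the old ones. This suffices because owners need only rank
  -- weakly lower, and whatever a new member envies is held in `S`.
  refine ⟨fun i => if i ∈ S then r i else B + 1, ?_, ?_, ?_, ?_⟩
  · intro i hi j hj o hio hjo
    by_cases hiS : i ∈ S <;> by_cases hjS : j ∈ S
    · exact hr.inj i hiS j hjS o (hagree i hiS ▸ hio) (hagree j hjS ▸ hjo)
    · exact absurd (hagree i hiS ▸ hio) (hfresh j (hRS j hj hjS) i hiS o hjo)
    · exact absurd (hagree j hjS ▸ hjo) (hfresh i (hRS i hi hiS) j hjS o hio)
    · exact hinj i (hRS i hi hiS) j (hRS j hj hjS) o hio hjo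
  · intro i hi o hio k hk
    by_cases hiS : i ∈ S
    · exact Or.inl (hr.owner_mem i hiS o (hagree i hiS ▸ hio) k hk)
    · exact howner i (hRS i hi hiS) o hio k hk
  · intro i hi o hio k hk
    by_cases hiS : i ∈ S
    · have h1 := hr.owner_mem i hiS o (hagree i hiS ▸ hio) k hk
      have h2 := hr.owner_le i hiS o (hagree i hiS ▸ hio) k hk
      simpa [hiS, h1] using h2
    · have := hB' k
      simp only [hiS, if_false]
      split_ifs <;> omega
  · intro i hi b hb
    by_cases hiS : i ∈ S
    · obtain ⟨o, rfl, j, hjS, hj, hlt⟩ := hr.better_lt i hiS b (hagree i hiS ▸ hb)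
      exact ⟨o, rfl, j, Or.inl hjS, (hagree j hjS).trans hj, by simpa [hiS, hjS] using hlt⟩
    · obtain ⟨o, rfl, j, hjS, hj⟩ := hbetter i (hRS i hi hiS) b hb
      have := hB' j
      exact ⟨o, rfl, j, Or.inl hjS, (hagree j hjS).trans hj, by simp only [hiS, hjS]; simp; omega⟩

/-- `a` holds an object owned by `b`. -/
def HoldsFrom (w : O → I) (μ : I → Option O) (a b : I) : Prop := ∃ o, μ a = some o ∧ w o = b

/-! ### Ranked allocations lie in every core, and in the nonempty strong core. -/

section Cores

variable {w : O → I} {μ σ : I → Option O} {r : I → ℕ} {C S : Set I}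

theorem mem_endowment (hw : ∀ o, E.owners o = {w o}) {o : O} : o ∈ E.endowment C ↔ w o ∈ C := by
  simp [endowment, hw]

/-- With single owners, control is reachability from holder to owner, so the iteration can be
replaced by chains along which ranks are monotone. -/
theorem mem_iUnion_controlSeq (hw : ∀ o, E.owners o = {w o}) {x : I} :
    x ∈ ⋃ k, E.controlSeq C μ k ↔ ∃ c ∈ C, Relation.ReflTransGen (HoldsFrom w μ) x c := by
  constructor
  · intro hx
    obtain ⟨k, hk⟩ := Set.mem_iUnion.1 hx
    clear hx
    induction k generalizing x with
    | zero => exact ⟨x, hk, .refl⟩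
    | succ k ih =>
      rcases hk with hk | ⟨o, ho, hxo⟩
      · exact ih hk
      · obtain ⟨c, hc, h⟩ := ih ((mem_endowment hw).1 ho)
        exact ⟨c, hc, .head ⟨o, hxo, rfl⟩ h⟩
  · rintro ⟨c, hc, h⟩
    induction h using Relation.ReflTransGen.head_induction_on with
    | refl => exact Set.mem_iUnion.2 ⟨0, hc⟩
    | head hab _ ih =>
      obtain ⟨o, hao, rfl⟩ := hab
      obtain ⟨k, hk⟩ := Set.mem_iUnion.1 ih
      exact Set.mem_iUnion.2 ⟨k + 1, Or.inr ⟨o, (mem_endowment hw).2 hk, hao⟩⟩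

theorem mem_controlled (hw : ∀ o, E.owners o = {w o}) {o : O} :
    o ∈ E.controlled C μ ↔ ∃ c ∈ C, Relation.ReflTransGen (HoldsFrom w μ) (w o) c := by
  rw [controlled, mem_endowment hw, mem_iUnion_controlSeq hw]

theorem IsRanking.le_of_reaches (hw : ∀ o, E.owners o = {w o})
    (hr : E.IsRanking μ Set.univ r) {x c : I}
    (h : Relation.ReflTransGen (HoldsFrom w μ) x c) : r c ≤ r x := by
  induction h with
  | refl => exact le_rfl
  | tail _ hbc ih =>
    obtain ⟨o, ho, rfl⟩ := hbc
    exact (hr.owner_le _ trivial o ho _ (by simp [hw])).trans ih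

theorem IsRanking.isAllocation (hr : E.IsRanking μ Set.univ r) : IsAllocation μ :=
  fun i j o hi hj => hr.inj i trivial j trivial o hi hj

/-- A gainer of minimal rank takes the object of an agent of smaller rank. -/
theorem IsRanking.exists_minimal_gainer (hr : E.IsRanking μ Set.univ r) (hσ : IsAllocation σ)
    (hne : ∃ i ∈ C, E.prefers i (σ i) (μ i)) :
    ∃ i ∈ C, E.prefers i (σ i) (μ i) ∧ (∀ k ∈ C, E.prefers k (σ k) (μ k) → r i ≤ r k) ∧
      ∃ o j, σ i = some o ∧ μ j = some o ∧ σ j ≠ μ j ∧ r j < r i := by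
  obtain ⟨i, ⟨hiC, hi⟩, hmin⟩ :=
    exists_minimalFor_of_wellFoundedLT (fun i => i ∈ C ∧ E.prefers i (σ i) (μ i)) r hne
  obtain ⟨o, ho, j, -, hj, hlt⟩ := hr.better_lt i trivial _ hi
  refine ⟨i, hiC, hi, fun k hk hk' => ?_, o, j, ho, hj, fun h => ?_, hlt⟩
  · exact (le_total (r i) (r k)).elim id (hmin ⟨hk, hk'⟩)
  · exact hlt.ne (congrArg r (hσ j i o (h.trans hj) ho))

/-- A gainer of minimal rank takes the object of an agent of smaller rank, who loses. -/
theorem IsRanking.exists_loser (hr : E.IsRanking μ Set.univ r) (hσ : IsAllocation σ)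
    (hne : ∃ i, E.prefers i (σ i) (μ i)) :
    ∃ i j, (∀ k, E.prefers k (σ k) (μ k) → r i ≤ r k) ∧ E.prefers j (μ j) (σ j) ∧ r j < r i := by
  obtain ⟨i, -, -, hmin, o, j, -, -, hne, hlt⟩ :=
    hr.exists_minimal_gainer (C := Set.univ) hσ (by simpa using hne)
  refine ⟨i, j, fun k => hmin k trivial, ?_, hlt⟩
  by_contra hj
  rcases E.weaklyPrefers_of_not_prefers hj with h | h
  · exact hne h
  · exact absurd (hmin j trivial h) (by omega)

theorem IsRanking.mem_exclusionCore (hw : ∀ o, E.owners o = {w o})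
    (hr : E.IsRanking μ Set.univ r) : μ ∈ E.exclusionCore := by
  refine ⟨hr.isAllocation, ?_⟩
  rintro ⟨C, σ, ⟨c, hc⟩, hσ, hgain, hlose⟩
  obtain ⟨i, j, hmin, hj, hlt⟩ := hr.exists_loser hσ ⟨c, hgain c hc⟩
  obtain ⟨o, ho, hjo⟩ := hlose j hj
  obtain ⟨d, hd, hreach⟩ := (mem_controlled hw).1 ho
  -- The chain leads from the loser `j` down to a gainer `d`, so `r d ≤ r j < r i`, against the
  -- minimality of `r i`.
  have h1 := hr.le_of_reaches hw (.head ⟨o, hjo, rfl⟩ hreach)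
  have h2 := hmin d (hgain d hd)
  omega

theorem IsRanking.mem_refinedExclusionCore (hw : ∀ o, E.owners o = {w o})
    (hr : E.IsRanking μ Set.univ r) : μ ∈ E.refinedExclusionCore := by
  refine ⟨hr.isAllocation, ?_⟩
  rintro ⟨C, σ, -, hσ, ⟨hweak, g, hgC, hg⟩, hlose, hcond⟩
  obtain ⟨i, j, hmin, hj, hlt⟩ := hr.exists_loser hσ ⟨g, hg⟩
  obtain ⟨o, ho, hjo⟩ := hlose j hj
  obtain ⟨d, hd, hreach⟩ := (mem_controlled hw).1 ho
  have hdj := hr.le_of_reaches hw (.head ⟨o, hjo, rfl⟩ hreach)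
  rcases hweak d hd with hd' | hd'
  · have hdU : d ∈ unaffected C μ σ := ⟨hd, hd'⟩
    rcases hcond ⟨d, hdU⟩ with ⟨-, hnot⟩ | ⟨hself, hminimal⟩
    · exact hnot j hj ⟨o, (mem_controlled hw).2 ⟨d, hdU, hreach⟩, hjo⟩
    · have hclosed : ∀ x ∈ C, ∀ y, HoldsFrom w σ x y → y ∈ C := by
        rintro x hx y ⟨a, ha, rfl⟩
        exact (mem_endowment hw).1 (hself x hx a ha)
      -- The members of `C` reached from `d` in `σ` form a self-enforcing set; minimality of `C`
      -- makes it all of `C`.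
      have hdg : Relation.ReflTransGen (HoldsFrom w σ) d g := by
        by_contra hdg
        refine hminimal {x ∈ C | Relation.ReflTransGen (HoldsFrom w σ) d x} ⟨d, hd, .refl⟩
          ⟨fun x hx => hx.1, fun h => hdg (h hgC).2⟩ ?_
        rintro x ⟨hx, hdx⟩ a ha
        exact (mem_endowment hw).2 ⟨hclosed x hx _ ⟨a, ha, rfl⟩, hdx.tail ⟨a, ha, rfl⟩⟩
      -- Ranks do not increase along the chain while its members are unaffected, and the first
      -- gainer met has rank at least `r i`.
      have key : ∀ x, Relation.ReflTransGen (HoldsFrom w σ) x g → x ∈ C → r i ≤ r x := by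
        intro x hx
        induction hx using Relation.ReflTransGen.head_induction_on with
        | refl => exact fun _ => hmin g hg
        | @head x y hxy _ ih =>
          intro hxC
          rcases hweak x hxC with h | h
          · refine (ih (hclosed x hxC y hxy)).trans ?_
            obtain ⟨a, ha, rfl⟩ := hxy
            exact hr.owner_le x trivial a (h ▸ ha) _ (by simp [hw])
          · exact hmin x h
      have := key d hdg hd
      omega
  · have := hmin d hd'
    omega

theorem IsRanking.mem_rectifiedCore (hw : ∀ o, E.owners o = {w o})
    (hr : E.IsRanking μ Set.univ r) : μ ∈ E.rectifiedCore := by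
  refine ⟨hr.isAllocation, ?_⟩
  rintro ⟨C, σ, -, hσ, ⟨hweak, hgain⟩, hself, hcond⟩
  obtain ⟨i, hiC, hi, hmin, o, j, hio, hjo, hne, hlt⟩ := hr.exists_minimal_gainer hσ hgain
  have hunaff : ∀ x ∈ C, r x < r i → x ∈ unaffected C μ σ := by
    intro x hx hxi
    rcases hweak x hx with h | h
    · exact ⟨hx, h⟩
    · exact absurd (hmin x hx h) (by omega)
  have hjC : j ∉ C := fun hjC => hne (hunaff j hjC hlt).2
  have hclosed : ∀ x ∈ C, ∀ y, HoldsFrom w σ x y → y ∈ C := by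
    rintro x hx y ⟨a, ha, rfl⟩
    exact (mem_endowment hw).1 (hself x hx a ha)
  have hle : r (w o) ≤ r j := hr.owner_le j trivial o hjo _ (by simp [hw])
  -- Members of `C` ranked below `i` are unaffected, so the chain from the owner of `o` never climbs
  -- back to rank `r i`. The agents on it serve as the set `C'` that the rectification condition
  -- forbids.
  have hreach : ∀ x, Relation.ReflTransGen (HoldsFrom w σ) (w o) x → x ∈ C ∧ r x < r i := by
    intro x hx
    induction hx with
    | refl => exact ⟨hclosed i hiC _ ⟨o, hio, rfl⟩, by omega⟩
    | tail _ hxy ih =>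
      refine ⟨hclosed _ ih.1 _ hxy, ?_⟩
      obtain ⟨a, ha, rfl⟩ := hxy
      have := hr.owner_le _ trivial a ((hunaff _ ih.1 ih.2).2 ▸ ha) (w a) (by simp [hw])
      exact this.trans_lt ih.2
  refine hcond {x | Relation.ReflTransGen (HoldsFrom w σ) (w o) x} ⟨w o, .refl⟩
    (fun x hx => hunaff x (hreach x hx).1 (hreach x hx).2)
    (fun x hx a ha => (mem_endowment hw).2 (Relation.ReflTransGen.tail hx ⟨a, ha, rfl⟩)) i
    ⟨hiC, fun h => (hreach i h).2.false⟩ o hio ((mem_endowment hw).2 Relation.ReflTransGen.refl)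
    j hjC hjo

/-- A ranked allocation equals every allocation in the strong core. -/
theorem IsRanking.eq_of_mem_strongCore (hr : E.IsRanking μ Set.univ r) {ν : I → Option O}
    (hν : ν ∈ E.strongCore) : μ = ν := by
  by_contra hne
  obtain ⟨i, hi, hmin⟩ :=
    exists_minimalFor_of_wellFoundedLT (fun i => μ i ≠ ν i) r (Function.ne_iff.1 hne)
  have hsame : ∀ j, r j < r i → μ j = ν j := fun j hj => by
    by_contra h
    exact absurd (hmin h hj.le) (by omega)
  have hweak : ∀ j, r j ≤ r i → E.weaklyPrefers j (μ j) (ν j) := by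
    refine fun j hj => E.weaklyPrefers_of_not_prefers fun hb => ?_
    -- The envied object is held in `μ` by some `k` of rank below `r i`, where `μ` and `ν` agree;
    -- `ν` would assign it twice.
    obtain ⟨o, ho, k, -, hk, hlt⟩ := hr.better_lt j trivial _ hb
    have hkj := hν.1 k j o ((hsame k (by omega)).symm.trans hk) ho
    exact hlt.ne (congrArg r hkj)
  -- A lower set of ranks is self-enforcing in `μ`, hence weakly blocks `ν` via `μ`.
  refine hν.2 ⟨{j | r j ≤ r i}, μ, ⟨i, le_rfl (a := r i)⟩, hr.isAllocation,
    ⟨hweak, i, le_rfl (a := r i), (hweak i le_rfl).resolve_left hi⟩, ?_⟩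
  exact fun j hj o hjo k hk => (hr.owner_le j trivial o hjo k hk).trans hj

theorem strongCore_subset_rectifiedCore : E.strongCore ⊆ E.rectifiedCore :=
  fun _ hμ => ⟨hμ.1, fun ⟨C, σ, hC, hσ, himp, hself, _⟩ => hμ.2 ⟨C, σ, hC, hσ, himp, hself⟩⟩

theorem refinedExclusionCore_subset_exclusionCore :
    E.refinedExclusionCore ⊆ E.exclusionCore := by
  rintro μ ⟨hμ, h⟩
  refine ⟨hμ, fun ⟨C, σ, hC, hσ, hgain, hlose⟩ => h ⟨C, σ, hC, hσ, ⟨?_, ?_⟩, hlose, ?_⟩⟩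
  · exact fun i hi => Or.inr (hgain i hi)
  · exact hC.imp fun i hi => ⟨hi, hgain i hi⟩
  · rintro ⟨i, hi, heq⟩
    exact absurd (heq ▸ hgain i hi) (E.prefers_irrefl i _)

/-- Handing `b` to `i` hurts nobody. In the exclusion sense `{i}` blocks; in the rectification sense
the grand coalition does, as nothing is assigned outside it. -/
theorem notMem_cores_of_unassigned (hμ : IsAllocation μ) {i : I} {b : Option O}
    (hb : E.prefers i b (μ i)) (hfree : ∀ o, b = some o → ∀ j, μ j ≠ some o) :
    μ ∉ E.exclusionCore ∧ μ ∉ E.rectifiedCore := by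
  classical
  have hσ : IsAllocation (Function.update μ i b) := by
    intro j k o hj hk
    by_cases hji : j = i <;> by_cases hki : k = i
    · rw [hji, hki]
    · subst hji
      simp only [Function.update_self, Function.update_of_ne hki] at hj hk
      exact absurd hk (hfree o hj k)
    · subst hki
      simp only [Function.update_self, Function.update_of_ne hji] at hj hk
      exact absurd hj (hfree o hk j)
    · simp only [Function.update_of_ne hji, Function.update_of_ne hki] at hj hk
      exact hμ j k o hj hk
  have hweak : ∀ j, E.weaklyPrefers j (Function.update μ i b j) (μ j) := by
    intro j
    by_cases hji : j = i
    · subst hji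
      exact Or.inr (by simpa using hb)
    · exact Or.inl (by simp [hji])
  constructor
  · refine fun h => h.2 ⟨{i}, _, ⟨i, rfl⟩, hσ, ?_, ?_⟩
    · rintro j rfl
      simpa using hb
    · exact fun j hj => absurd hj (E.not_prefers_of_weaklyPrefers (hweak j))
  · refine fun h => h.2 ⟨Set.univ, _, ⟨i, trivial⟩, hσ, ⟨fun j _ => hweak j, i, trivial, ?_⟩, ?_, ?_⟩
    · simpa using hb
    · exact fun _ _ _ _ _ _ => trivial
    · exact fun _ _ _ _ _ _ _ _ _ k hk => absurd trivial hk

end Cores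
end Economy
end ComplexEndowments

/-! ### Allocations without a ranking are blocked. -/

namespace ComplexEndowments

namespace Economy

theorem exists_mem_periodicPts {α : Type*} [Finite α] (h : α → α) (x : α) :
    ∃ n, h^[n] x ∈ Function.periodicPts h := by
  obtain ⟨m, n, hne, heq⟩ := Finite.exists_ne_map_eq_of_infinite fun n => h^[n] x
  wlog hlt : m < n generalizing m n
  · exact this n m hne.symm heq.symm (by omega)
  refine ⟨m, n - m, by omega, ?_⟩
  change h^[n - m] (h^[m] x) = h^[m] x
  rw [← Function.iterate_add_apply, Nat.sub_add_cancel hlt.le]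
  exact heq.symm

/-- Going once around the orbit of `p` returns to `p`, so a property passed forward along the orbit
also passes backward. -/
theorem mem_of_apply_mem_of_mem_periodicPts {α : Type*} {h : α → α} {T : Set α}
    (hT : ∀ x ∈ T, x ∈ Function.periodicPts h → h x ∈ T) {p : α}
    (hp : p ∈ Function.periodicPts h) (hhp : h p ∈ T) : p ∈ T := by
  obtain ⟨n, hn, hper⟩ := hp
  have key : ∀ k, h^[k + 1] p ∈ T := by
    intro k
    induction k with
    | zero => exact hhp
    | succ k ih =>
      rw [Function.iterate_succ_apply']
      exact hT _ ih ⟨n, hn, hper.apply_iterate _⟩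
  have := key (n - 1)
  rwa [Nat.sub_add_cancel hn, hper.eq] at this

variable {I O : Type*} {E : Economy I O} {w : O → I} {μ : I → Option O}

/-- Fix a maximal ranked set `S`, and let each outsider want her favorite among what `S` leaves.
Link her to its owner if that owner is outside `S`, otherwise to its holder in `μ`. Periodic points
of this map can all receive their favorites at once, and by maximality one of them strictly gains.
-/
theorem exists_blocks_of_not_hasRanking [Finite I] [Finite O] (hw : ∀ o, E.owners o = {w o})
    (hμ : IsAllocation μ) (hnone : ∀ i, ¬ E.prefers i none (μ i))
    (hunassigned : ∀ i o, E.prefers i (some o) (μ i) → ∃ j, μ j = some o)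
    (hrank : ¬ E.HasRanking μ Set.univ) :
    ∃ σ, IsAllocation σ ∧ (∃ C : Set I, C.Nonempty ∧ E.ExclusionBlocks C μ σ) ∧
      ∃ D : Set I, D.Nonempty ∧ E.RectificationBlocks D μ σ := by
  classical
  obtain ⟨S, hS, hmax⟩ := (Set.toFinite {S : Set I | E.HasRanking μ S}).exists_maximal
    ⟨∅, E.hasRanking_empty μ⟩
  have hSowner : ∀ i ∈ S, ∀ o, μ i = some o → w o ∈ S := by
    intro i hi o ho
    obtain ⟨r, hr⟩ := hS
    exact hr.owner_mem i hi o ho _ (by simp [hw])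
  choose fav hfav hfavmax using fun i => E.exists_favorite i
    {a | ∀ j ∈ S, ∀ o, a = some o → μ j ≠ some o} ⟨none, by simp⟩
  have hself : ∀ i, i ∉ S → ∀ j ∈ S, ∀ o, μ i = some o → μ j ≠ some o :=
    fun i hi j hj o hio hjo => hi (hμ i j o hio hjo ▸ hj)
  have hge : ∀ i, i ∉ S → ¬ E.prefers i (μ i) (fav i) := fun i hi => hfavmax i _ (hself i hi)
  -- Such an `R` could be added to `S` as a further rank.
  have hext : ∀ R : Set I, R.Nonempty → (∀ i ∈ R, i ∉ S) → (∀ i ∈ R, fav i = μ i) →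
      ¬ ∀ i ∈ R, ∀ o, μ i = some o → w o ∈ S ∪ R := by
    intro R ⟨i, hi⟩ hRS hR howner
    refine hRS i hi (hmax (y := S ∪ R) ?_ Set.subset_union_left (Or.inr hi))
    refine HasRanking.union hS (fun _ _ => rfl) (fun i _ j _ o => hμ i j o)
      (fun i hi => hself i (hRS i hi)) (fun i hi o ho k hk => ?_) (fun i hi b hb => ?_)
    · rw [hw] at hk
      exact hk ▸ howner i hi o ho
    · by_contra hcon
      refine hfavmax i b (fun j hj o ho hjo => hcon ⟨o, ho, j, hj, hjo⟩) (hR i hi ▸ hb)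
  have hstuck : ∀ i, i ∉ S → fav i = μ i → ∃ o, μ i = some o ∧ w o ∉ S := by
    intro i hi heq
    by_contra! hcon
    refine hext {i} ⟨i, rfl⟩ (by simpa using hi) (by simpa using heq) ?_
    rintro _ rfl o ho
    exact Or.inl (hcon o ho)
  have hnext : ∀ i, ∃ k, i ∉ S → k ∉ S ∧ ∃ o, fav i = some o ∧
      (w o ∉ S ∧ k = w o ∨ w o ∈ S ∧ μ k = some o) := by
    intro i
    by_cases hi : i ∈ S
    · exact ⟨i, fun h => absurd hi h⟩
    rcases E.weaklyPrefers_of_not_prefers (hge i hi) with heq | hlt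
    · obtain ⟨o, ho, hwo⟩ := hstuck i hi heq
      exact ⟨w o, fun _ => ⟨hwo, o, heq.trans ho, Or.inl ⟨hwo, rfl⟩⟩⟩
    · rcases hf : fav i with _ | o
      · exact absurd (hf ▸ hlt) (hnone i)
      · by_cases hwo : w o ∈ S
        · obtain ⟨k, hk⟩ := hunassigned i o (hf ▸ hlt)
          exact ⟨k, fun _ => ⟨fun hkS => hfav i k hkS o hf hk, o, rfl, Or.inr ⟨hwo, hk⟩⟩⟩
        · exact ⟨w o, fun _ => ⟨hwo, o, rfl, Or.inl ⟨hwo, rfl⟩⟩⟩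
  choose h hh using hnext
  obtain ⟨P, hPdef⟩ : ∃ P : Set I, P = {x | x ∉ S ∧ x ∈ Function.periodicPts h} := ⟨_, rfl⟩
  have hPS : ∀ x ∈ P, x ∉ S := fun x hx => (hPdef ▸ hx : _ ∧ _).1
  have hPper : ∀ x ∈ P, x ∈ Function.periodicPts h := fun x hx => (hPdef ▸ hx : _ ∧ _).2
  have hPmaps : ∀ x ∈ P, h x ∈ P := fun x hx => hPdef ▸
    ⟨(hh x (hPS x hx)).1, (Function.bijOn_periodicPts h).mapsTo (hPper x hx)⟩
  -- The favorite determines the successor under `h`, which is injective on periodic points.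
  have hPinj : ∀ x ∈ P, ∀ y ∈ P, ∀ o, fav x = some o → fav y = some o → x = y := by
    intro x hx y hy o hxo hyo
    refine (Function.bijOn_periodicPts h).injOn (hPper x hx) (hPper y hy) ?_
    obtain ⟨-, o1, ho1, h1⟩ := hh x (hPS x hx)
    obtain ⟨-, o2, ho2, h2⟩ := hh y (hPS y hy)
    obtain rfl : o = o1 := Option.some_injective _ (hxo.symm.trans ho1)
    obtain rfl : o = o2 := Option.some_injective _ (hyo.symm.trans ho2)
    rcases h1 with ⟨h1, h1'⟩ | ⟨h1, h1'⟩ <;> rcases h2 with ⟨h2, h2'⟩ | ⟨h2, h2'⟩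
    · rw [h1', h2']
    · exact absurd h2 h1
    · exact absurd h1 h2
    · exact hμ _ _ o h1' h2'
  have hPne : P.Nonempty := by
    have hSne : ∃ x, x ∉ S := by
      by_contra! hall
      exact hrank (Set.eq_univ_of_forall hall ▸ hS)
    obtain ⟨x, hx⟩ := hSne
    have hmaps : ∀ n, h^[n] x ∉ S := by
      intro n
      induction n with
      | zero => exact hx
      | succ n ih =>
        rw [Function.iterate_succ_apply']
        exact (hh _ ih).1
    obtain ⟨n, hn⟩ := exists_mem_periodicPts h x
    refine ⟨h^[n] x, ?_⟩
    rw [hPdef]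
    exact ⟨hmaps n, hn⟩
  have hPowner : ∀ x ∈ P, ∀ o, fav x = some o → w o ∈ S ∪ P := by
    intro x hx o ho
    obtain ⟨-, o1, ho1, h1⟩ := hh x (hPS x hx)
    obtain rfl : o = o1 := Option.some_injective _ (ho.symm.trans ho1)
    rcases h1 with ⟨_, h1⟩ | ⟨h1, _⟩
    · exact Or.inr (h1 ▸ hPmaps x hx)
    · exact Or.inl h1
  have hgainer : ∃ g ∈ P, E.prefers g (fav g) (μ g) := by
    by_contra! hcon
    have heq : ∀ x ∈ P, fav x = μ x := fun x hx =>
      (E.weaklyPrefers_of_not_prefers (hge x (hPS x hx))).resolve_right (hcon x hx)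
    exact hext P hPne hPS heq fun x hx o ho => hPowner x hx o ((heq x hx).trans ho)
  have hholds : ∀ x ∈ P, fav x = μ x → HoldsFrom w μ x (h x) := by
    intro x hx heq
    obtain ⟨o, ho, hwo⟩ := hstuck x (hPS x hx) heq
    obtain ⟨-, o1, ho1, h1⟩ := hh x (hPS x hx)
    obtain rfl : o = o1 := Option.some_injective _ (ho.symm.trans (heq.symm.trans ho1))
    rcases h1 with ⟨_, h1⟩ | ⟨h1, _⟩
    · exact ⟨o, ho, h1.symm⟩
    · exact absurd h1 hwo
  -- Outside `P`, exactly those whose object is taken by `P` drop to the null object; `S` is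
  -- untouched since no favorite is held there.
  obtain ⟨σ, hσ⟩ : ∃ σ : I → Option O, σ = fun x => if x ∈ P then fav x else
    if ∃ p ∈ P, fav p = μ x then none else μ x := ⟨_, rfl⟩
  have hσP : ∀ x ∈ P, σ x = fav x := fun x hx => by simp [hσ, hx]
  have hσS : ∀ x ∈ S, σ x = μ x := by
    intro x hx
    have hxP : x ∉ P := fun hxP => hPS x hxP hx
    simp only [hσ, hxP, if_false]
    split_ifs with hp
    · obtain ⟨p, hp, hpx⟩ := hp
      rcases hμx : μ x with _ | o
      · rfl
      · exact absurd hμx (hfav p x hx o (hpx.trans hμx))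
    · rfl
  have hσout : ∀ x, x ∉ P → ∀ o, σ x = some o → μ x = some o ∧ ∀ p ∈ P, fav p ≠ some o := by
    intro x hx o ho
    simp only [hσ, hx, if_false] at ho
    split_ifs at ho with hp
    exact ⟨ho, fun p hpP hpo => hp ⟨p, hpP, hpo.trans ho.symm⟩⟩
  refine ⟨σ, ?_, ⟨{x ∈ P | E.prefers x (fav x) (μ x)}, hgainer, ?_, ?_⟩,
    S ∪ P, hPne.inr, ⟨?_, ?_⟩, ?_, ?_⟩
  · intro i j o hi hj
    by_cases hiP : i ∈ P <;> by_cases hjP : j ∈ P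
    · exact hPinj i hiP j hjP o (hσP i hiP ▸ hi) (hσP j hjP ▸ hj)
    · exact absurd (hσP i hiP ▸ hi) ((hσout j hjP o hj).2 i hiP)
    · exact absurd (hσP j hjP ▸ hj) ((hσout i hiP o hi).2 j hjP)
    · exact hμ i j o (hσout i hiP o hi).1 (hσout j hjP o hj).1
  · rintro x ⟨hx, hlt⟩
    rwa [hσP x hx]
  · intro j hj
    have hjP : j ∉ P := fun hjP => hge j (hPS j hjP) (hσP j hjP ▸ hj)
    simp only [hσ, hjP, if_false] at hj
    split_ifs at hj with hp
    swap
    · exact absurd hj (E.prefers_irrefl j _)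
    obtain ⟨p, hpP, hpj⟩ := hp
    obtain ⟨-, o, ho, h1⟩ := hh p (hPS p hpP)
    rcases h1 with ⟨hwo, h1⟩ | ⟨hwo, h1⟩
    swap
    · exact absurd (hμ _ _ o h1 (hpj.symm.trans ho) ▸ hPmaps p hpP) hjP
    refine ⟨o, ?_, hpj.symm.trans ho⟩
    have hpgain : E.prefers p (fav p) (μ p) := by
      refine (E.weaklyPrefers_of_not_prefers (hge p (hPS p hpP))).resolve_left fun heq => ?_
      exact hjP (hμ p j o (heq.symm.trans ho) (hpj.symm.trans ho) ▸ hpP)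
    rw [mem_controlled hw, ← h1]
    by_contra hnot
    -- From the owner `h p` of the lost object, follow `h`: each step at an unaffected agent goes
    -- from holder to owner in `μ`, and the orbit comes back to the gainer `p`, so some gainer is
    -- reached.
    have := mem_of_apply_mem_of_mem_periodicPts (h := h) (p := p)
      (T := {x ∈ P | ¬ ∃ c ∈ {x ∈ P | E.prefers x (fav x) (μ x)},
        Relation.ReflTransGen (HoldsFrom w μ) x c}) ?_ (hPper p hpP) ⟨hPmaps p hpP, hnot⟩
    · exact this.2 ⟨p, ⟨hpP, hpgain⟩, .refl⟩
    · rintro x ⟨hx, hxnot⟩ -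
      refine ⟨hPmaps x hx, fun ⟨c, hc, hreach⟩ => hxnot ?_⟩
      rcases E.weaklyPrefers_of_not_prefers (hge x (hPS x hx)) with heq | hlt
      · exact ⟨c, hc, .head (hholds x hx heq) hreach⟩
      · exact ⟨x, ⟨hx, hlt⟩, .refl⟩
  · rintro x (hx | hx)
    · exact Or.inl (hσS x hx)
    · rw [hσP x hx]
      exact E.weaklyPrefers_of_not_prefers (hge x (hPS x hx))
  · obtain ⟨g, hg, hlt⟩ := hgainer
    exact ⟨g, Or.inr hg, hσP g hg ▸ hlt⟩
  · rintro x (hx | hx) o ho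
    · exact (mem_endowment hw).2 (Or.inl (hSowner x hx o (hσS x hx ▸ ho)))
    · exact (mem_endowment hw).2 (hPowner x hx o (hσP x hx ▸ ho))
  · rintro C' - hC' hself' i ⟨hiD, hiC'⟩ o hio hoC' k hk hko
    rcases hiD with hiS | hiP
    · exact hk (Or.inl (hμ i k o (hσS i hiS ▸ hio) hko ▸ hiS))
    rw [hσP i hiP] at hio
    obtain ⟨-, o1, ho1, h1⟩ := hh i (hPS i hiP)
    obtain rfl : o = o1 := Option.some_injective _ (hio.symm.trans ho1)
    rcases h1 with ⟨hwo, h1⟩ | ⟨hwo, h1⟩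
    swap
    · exact hk (Or.inr (hμ _ _ o h1 hko ▸ hPmaps i hiP))
    -- Unaffected members of `P` hold objects of their successors, so a self-enforcing `C'`
    -- containing `h i` contains the whole orbit, including `i`.
    have := mem_of_apply_mem_of_mem_periodicPts (h := h) (p := i) (T := C' ∩ P) ?_ (hPper i hiP)
      ⟨h1 ▸ (mem_endowment hw).1 hoC', hPmaps i hiP⟩
    · exact hiC' this.1
    · rintro x ⟨hxC', hx⟩ -
      obtain ⟨a, ha, hwa⟩ := hholds x hx ((hσP x hx).symm.trans (hC' hxC').2)
      exact ⟨hwa ▸ (mem_endowment hw).1 (hself' x hxC' a ((hC' hxC').2.trans ha)), hPmaps x hx⟩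

theorem hasRanking_of_mem_core [Finite I] [Finite O] (hw : ∀ o, E.owners o = {w o})
    (h : μ ∈ E.exclusionCore ∨ μ ∈ E.rectifiedCore) : E.HasRanking μ Set.univ := by
  have hμ : IsAllocation μ := h.elim (·.1) (·.1)
  have hfree : ∀ i b, (∀ o, b = some o → ∀ j, μ j ≠ some o) → ¬ E.prefers i b (μ i) := by
    intro i b hb hlt
    have := notMem_cores_of_unassigned hμ hlt hb
    exact h.elim this.1 this.2
  by_contra hrank
  obtain ⟨σ, hσ, ⟨C, hC, hCb⟩, D, hD, hDb⟩ := exists_blocks_of_not_hasRanking hw hμ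
    (fun i => hfree i none (by simp)) (fun i o hlt => by
      by_contra! hcon
      exact hfree i (some o) (fun a ha => Option.some_injective _ ha ▸ hcon) hlt) hrank
  exact h.elim (fun h => h.2 ⟨C, σ, hC, hσ, hCb⟩) (fun h => h.2 ⟨D, σ, hD, hσ, hDb⟩)

end Economy
end ComplexEndowments

/-! ### The algorithm under private ownership: no sharing, and cycles of arcs. -/

namespace ComplexEndowments

theorem highest_eq_some_iff {I : Type*} {L : List I} {S : Set I} (hS : S.Subsingleton) {j : I} :
    highest L S = some j ↔ j ∈ L ∧ j ∈ S := by
  classical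
  constructor
  · intro h
    exact ⟨List.mem_of_find?_eq_some h, by simpa using List.find?_some h⟩
  · rintro ⟨hjL, hjS⟩
    rcases h : highest L S with _ | k
    · exact absurd (decide_eq_true hjS) (List.find?_eq_none.1 h j hjL)
    · have hk : k ∈ S := by simpa using List.find?_some h
      rw [hS hk hjS]

namespace YState

open Economy

variable {I O : Type*} {E : Economy I O} {w : O → I} {L : List I} {s : YState I O}

/-- The agents `x` such that the top of the current order is reached from `x` along current arcs. -/
def reachTop (s : YState I O) : Set I :=
  {x | ∃ i, s.order.head? = some i ∧ Relation.ReflTransGen s.Next x i}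

/-- The invariants of the algorithm in an economy where `o` is owned by `w o` only. -/
structure Consistent (w : O → I) (s : YState I O) : Prop where
  shared_eq : ∀ o, s.shared o = ∅
  arc_iff : ∀ o j, s.objectArc o = some j ↔ w o = j ∧ j ∈ s.order
  agent_mem : ∀ i o, s.agentArc i = some o → i ∈ s.order
  mem_objects : ∀ o, o ∈ s.objects ↔ ∀ i, i ∉ s.order → s.assigned i ≠ some o

theorem consistent_init (hw : ∀ o, E.owners o = {w o}) :
    (init E L).Consistent w where
  shared_eq _ := rfl
  arc_iff o j := by
    change highest L (E.owners o) = some j ↔ _ ∧ j ∈ L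
    rw [hw, highest_eq_some_iff Set.subsingleton_singleton, and_comm, Set.mem_singleton_iff,
      eq_comm]
  agent_mem _ _ h := by cases h
  mem_objects o := by simp [init]

theorem Consistent.point (hs : s.Consistent w) {i : I} (hi : i ∈ s.order) (a : Option O) :
    (s.point i a).Consistent w where
  shared_eq := hs.shared_eq
  arc_iff := hs.arc_iff
  agent_mem j o h := by
    classical
    by_cases hji : j = i
    · exact hji ▸ hi
    · exact hs.agent_mem j o (by simpa [YState.point, hji] using h)
  mem_objects := hs.mem_objects

theorem mem_order_moveToTop {i j : I} (hj : j ∈ s.order) :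
    i ∈ (s.moveToTop j).order ↔ i ∈ s.order := by
  by_cases h : i = j <;> simp [moveToTop, h, hj]

theorem Consistent.moveToTop (hs : s.Consistent w) {j : I} (hj : j ∈ s.order) :
    (s.moveToTop j).Consistent w where
  shared_eq := hs.shared_eq
  arc_iff o k := by rw [mem_order_moveToTop hj]; exact hs.arc_iff o k
  agent_mem i o h := by rw [mem_order_moveToTop hj]; exact hs.agent_mem i o h
  mem_objects o := by simp only [mem_order_moveToTop hj]; exact hs.mem_objects o

theorem mem_order_remove {R : Set I} {new : O → Set I} {i : I} :
    i ∈ (s.remove R new).order ↔ i ∈ s.order ∧ i ∉ R := by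
  simp [remove]

theorem assigned_remove_of_mem {R : Set I} {new : O → Set I} {i : I} (hi : i ∈ R) :
    (s.remove R new).assigned i = s.agentArc i := by
  simp [remove, hi]

theorem assigned_remove_of_notMem {R : Set I} {new : O → Set I} {i : I} (hi : i ∉ R) :
    (s.remove R new).assigned i = s.assigned i := by
  simp [remove, hi]

theorem agentArc_remove {R : Set I} {new : O → Set I} {i : I} {o : O}
    (h : (s.remove R new).agentArc i = some o) :
    i ∉ R ∧ o ∉ s.targets R ∧ s.agentArc i = some o := by
  classical
  simp only [remove] at h
  split_ifs at h with hc
  push Not at hc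
  exact ⟨hc.1, fun ho => hc.2 o ho h, h⟩

theorem Consistent.remove (hw : ∀ o, E.owners o = {w o}) (hs : s.Consistent w) {R : Set I}
    {new : O → Set I} (hR : ∀ i ∈ R, i ∈ s.order) (hnew : ∀ o, new o = ∅) :
    ((s.remove R new).redirect E L).Consistent w where
  shared_eq o := by
    change (s.shared o ∪ new o) \ R = ∅
    simp [hs.shared_eq, hnew]
  arc_iff o j := by
    classical
    change (if ∃ i, s.objectArc o = some i ∧ i ∉ (s.remove R new).order then
      (highest L ((s.remove R new).remainingOwners E o)).or (highest L ((s.shared o ∪ new o) \ R))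
      else s.objectArc o) = some j ↔ w o = j ∧ j ∈ (s.remove R new).order
    have hown : ∀ k, k ∈ (s.remove R new).remainingOwners E o ↔
        k = w o ∧ k ∈ (s.remove R new).order := fun k => by
      simp [remainingOwners, hw]
    have hsub : ((s.remove R new).remainingOwners E o).Subsingleton := fun a ha b hb =>
      ((hown a).1 ha).1.trans ((hown b).1 hb).1.symm
    -- Once its only owner is gone, an object has no claimant left and points to nobody.
    split_ifs with hgone
    · obtain ⟨i, hi, hiR⟩ := hgone
      obtain rfl : w o = i := ((hs.arc_iff o i).1 hi).1
      have h1 : highest L ((s.remove R new).remainingOwners E o) = none :=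
        Option.eq_none_iff_forall_ne_some.2 fun k hk => by
          have := (hown k).1 ((highest_eq_some_iff hsub).1 hk).2
          exact hiR (this.1 ▸ this.2)
      have h2 : highest L ((s.shared o ∪ new o) \ R) = none :=
        Option.eq_none_iff_forall_ne_some.2 fun k hk => by
          rw [hs.shared_eq, hnew, Set.empty_union, Set.empty_sdiff,
            highest_eq_some_iff Set.subsingleton_empty] at hk
          exact hk.2
      rw [h1, h2]
      refine iff_of_false (by simp) ?_
      rintro ⟨rfl, h⟩
      exact hiR h
    · rw [hs.arc_iff]
      refine and_congr_right fun hj => ⟨fun h => ?_, fun h => (mem_order_remove.1 h).1⟩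
      by_contra hnot
      exact hgone ⟨j, (hs.arc_iff o j).2 ⟨hj, h⟩, hnot⟩
  agent_mem i o h := by
    obtain ⟨h1, -, h3⟩ := agentArc_remove (s := s) (new := new) h
    exact (mem_order_remove (new := new)).2 ⟨hs.agent_mem i o h3, h1⟩
  mem_objects o := by
    change o ∈ s.objects \ s.targets R ↔
      ∀ i, i ∉ (s.remove R new).order → (s.remove R new).assigned i ≠ some o
    rw [Set.mem_sdiff, hs.mem_objects]
    constructor
    · rintro ⟨h1, h2⟩ i hi
      by_cases hiR : i ∈ R
      · rw [assigned_remove_of_mem hiR]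
        exact fun h => h2 ⟨i, hiR, h⟩
      · rw [assigned_remove_of_notMem hiR]
        exact h1 i fun h => hi (mem_order_remove.2 ⟨h, hiR⟩)
    · refine fun h => ⟨fun i hi => ?_, ?_⟩
      · have hiR : i ∉ R := fun hiR => hi (hR i hiR)
        rw [← assigned_remove_of_notMem (new := new) hiR]
        exact h i fun h => hi (mem_order_remove.1 h).1
      · rintro ⟨i, hiR, hio⟩
        refine h i (fun h => (mem_order_remove.1 h).2 hiR) ?_
        rwa [assigned_remove_of_mem hiR]

theorem Consistent.next_iff (hs : s.Consistent w) {j k : I} :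
    s.Next j k ↔ ∃ o, s.agentArc j = some o ∧ w o = k ∧ k ∈ s.order := by
  simp only [Next, hs.arc_iff]

theorem Next.unique {i j k : I} (hj : s.Next i j) (hk : s.Next i k) : j = k := by
  obtain ⟨o, ho, hoj⟩ := hj
  obtain ⟨o', ho', hok⟩ := hk
  obtain rfl : o = o' := Option.some_injective _ (ho.symm.trans ho')
  exact Option.some_injective _ (hoj.symm.trans hok)

theorem OnCycle.exists_next {i j : I} (hi : s.OnCycle i) (hj : j ∈ s.cycle i) :
    ∃ k ∈ s.cycle i, s.Next j k := by
  have key : ∀ j, Relation.ReflTransGen s.Next i j → Relation.TransGen s.Next j i := by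
    intro j hj
    induction hj with
    | refl => exact hi
    | tail _ hjk ih =>
      obtain ⟨k', hjk', hk'i⟩ := Relation.TransGen.head'_iff.1 ih
      obtain rfl := hjk.unique hjk'
      rcases Relation.reflTransGen_iff_eq_or_transGen.1 hk'i with rfl | h
      · exact hi
      · exact h
  obtain ⟨k, hjk, -⟩ := Relation.TransGen.head'_iff.1 (key j hj.to_reflTransGen)
  exact ⟨k, Relation.TransGen.tail hj hjk, hjk⟩

theorem OnCycle.exists_prev {i k : I} (hi : s.OnCycle i) (hk : k ∈ s.cycle i) :
    ∃ j ∈ s.cycle i, s.Next j k := by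
  obtain ⟨j, hij, hjk⟩ := Relation.TransGen.tail'_iff.1 hk
  rcases Relation.reflTransGen_iff_eq_or_transGen.1 hij with rfl | h
  · exact ⟨j, hi, hjk⟩
  · exact ⟨j, h, hjk⟩

/-- Every agent on the cycle has a predecessor there, so the successor map is surjective on a finite
set, hence injective. -/
theorem OnCycle.injOn [Finite I] {i j j' k : I} (hi : s.OnCycle i) (hj : j ∈ s.cycle i)
    (hj' : j' ∈ s.cycle i) (hjk : s.Next j k) (hjk' : s.Next j' k) : j = j' := by
  choose f hf hnext using fun x : s.cycle i => hi.exists_next x.2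
  have hsurj : Function.Surjective fun x => (⟨f x, hf x⟩ : s.cycle i) := by
    rintro ⟨y, hy⟩
    obtain ⟨x, hx, hxy⟩ := hi.exists_prev hy
    exact ⟨⟨x, hx⟩, Subtype.ext ((hnext ⟨x, hx⟩).unique hxy)⟩
  have h1 : f ⟨j, hj⟩ = f ⟨j', hj'⟩ :=
    ((hnext ⟨j, hj⟩).unique hjk).trans (hjk'.unique (hnext ⟨j', hj'⟩))
  exact congrArg Subtype.val (Finite.injective_iff_surjective.2 hsurj (Subtype.ext h1))

theorem Consistent.cycle_subset_order (hs : s.Consistent w) {i j : I} (hj : j ∈ s.cycle i) :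
    j ∈ s.order := by
  obtain ⟨k, -, hkj⟩ := Relation.TransGen.tail'_iff.1 hj
  obtain ⟨o, -, -, h⟩ := hs.next_iff.1 hkj
  exact h

/-- The only possible claimant of a cycle object is its owner, who is then on the cycle herself, so
sharing never starts. -/
theorem Consistent.newSharers_eq (hw : ∀ o, E.owners o = {w o}) (hs : s.Consistent w) (i : I)
    (a : O) : s.newSharers E (s.cycle i) a = ∅ := by
  refine Set.eq_empty_of_forall_notMem ?_
  rintro k ⟨hk, -, ⟨b, ⟨j, hj, hjb⟩, hkb⟩, -⟩
  rcases hkb with ⟨hkb, hko⟩ | hkb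
  · rw [hw] at hkb
    exact hk (Relation.TransGen.tail hj (hs.next_iff.2 ⟨b, hjb, hkb.symm, hko⟩))
  · simp [hs.shared_eq] at hkb

/-! ### Every outcome of the algorithm is ranked. -/

theorem Consistent.hasRanking_remove [Finite I] (hw : ∀ o, E.owners o = {w o})
    (hs : s.Consistent w) {R : Set I} {new : O → Set I} (hR : ∀ i ∈ R, i ∈ s.order)
    (hrank : E.HasRanking s.assigned {i | i ∉ s.order})
    (hfav : ∀ i ∈ R, s.IsFavorite E i (s.agentArc i))
    (howner : ∀ i ∈ R, ∀ o, s.agentArc i = some o → w o ∈ s.order → w o ∈ R)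
    (hinj : ∀ i ∈ R, ∀ j ∈ R, ∀ o, s.agentArc i = some o → s.agentArc j = some o → i = j) :
    E.HasRanking (s.remove R new).assigned {i | i ∉ (s.remove R new).order} := by
  have hset : {i | i ∉ (s.remove R new).order} = {i | i ∉ s.order} ∪ R := by
    ext i
    simp only [Set.mem_ofPred_eq, mem_order_remove, Set.mem_union]
    tauto
  rw [hset]
  refine HasRanking.union hrank ?_ ?_ ?_ ?_ ?_
  · exact fun i hi => assigned_remove_of_notMem fun hiR => hi (hR i hiR)
  · intro i hi j hj o
    rw [assigned_remove_of_mem hi, assigned_remove_of_mem hj]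
    exact hinj i hi j hj o
  · intro i hi j hj o
    rw [assigned_remove_of_mem hi]
    exact fun hio => (hs.mem_objects o).1 ((hfav i hi).1 o hio) j hj
  · intro i hi o
    rw [assigned_remove_of_mem hi]
    intro hio k hk
    rw [hw] at hk
    obtain rfl : k = w o := hk
    by_cases hwo : w o ∈ s.order
    · exact Or.inr (howner i hi o hio hwo)
    · exact Or.inl hwo
  · intro i hi b
    rw [assigned_remove_of_mem hi]
    intro hb
    -- Anything better than a favorite is no longer available, so an agent removed earlier holds it.
    have hav : ¬ s.Available b := fun hav =>
      E.not_prefers_of_weaklyPrefers ((hfav i hi).2 b hav) hb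
    simp only [Available, not_forall] at hav
    obtain ⟨o, rfl, ho⟩ := hav
    rw [hs.mem_objects] at ho
    push Not at ho
    obtain ⟨j, hj, hjo⟩ := ho
    exact ⟨o, rfl, j, hj, hjo⟩

/-- Besides consistency: arcs lead to favorites, and the removed agents are ranked. -/
structure Ranked (E : Economy I O) (w : O → I) (s : YState I O) : Prop
    extends s.Consistent w where
  arc_favorite : ∀ i o, s.agentArc i = some o → s.IsFavorite E i (some o)
  hasRanking : E.HasRanking s.assigned {i | i ∉ s.order}

theorem agentArc_point_self (s : YState I O) (i : I) (a : Option O) :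
    (s.point i a).agentArc i = a := by
  simp [point]

theorem agentArc_point_of_ne {i j : I} (h : j ≠ i) (a : Option O) :
    (s.point i a).agentArc j = s.agentArc j := by
  simp [point, h]

theorem IsFavorite.remove {R : Set I} {new : O → Set I} {i : I} {o : O}
    (h : s.IsFavorite E i (some o)) (ho : o ∉ s.targets R) :
    ((s.remove R new).redirect E L).IsFavorite E i (some o) := by
  refine ⟨fun a ha => ?_, fun b hb => h.2 b fun a ha => (hb a ha).1⟩
  cases ha
  exact ⟨h.1 o rfl, ho⟩

theorem Ranked.point (hs : s.Ranked E w) {i : I} {a : Option O} (hi : i ∈ s.order)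
    (ha : s.IsFavorite E i a) : (s.point i a).Ranked E w where
  toConsistent := hs.toConsistent.point hi a
  arc_favorite j o h := by
    by_cases hji : j = i
    · subst hji
      rw [agentArc_point_self] at h
      exact h ▸ ha
    · exact hs.arc_favorite j o (agentArc_point_of_ne hji a ▸ h)
  hasRanking := hs.hasRanking

theorem Ranked.step [Finite I] (hw : ∀ o, E.owners o = {w o}) {t : YState I O}
    (hs : s.Ranked E w) (hst : Step E L s t) : t.Ranked E w := by
  cases hst with
  | leave i rest a htop hfav hfree =>
    have hi : i ∈ s.order := by simp [htop]
    have hp := hs.point hi hfav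
    have hR : ∀ j ∈ ({i} : Set I), j ∈ (s.point i a).order := by
      rintro _ rfl
      exact hi
    refine ⟨hp.toConsistent.remove hw hR fun _ => rfl, fun j o h => ?_, ?_⟩
    · obtain ⟨-, h2, h3⟩ := agentArc_remove (s := s.point i a) (new := fun _ => ∅) h
      exact (hp.arc_favorite j o h3).remove h2
    · refine hp.toConsistent.hasRanking_remove (new := fun _ => ∅) hw hR hp.hasRanking ?_ ?_ ?_
      · rintro _ rfl
        rw [agentArc_point_self]
        exact hfav
      · rintro _ rfl o ho hwo
        rw [agentArc_point_self] at ho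
        -- An object that points to nobody has lost its owner, so the owner already belongs to the
        -- ranked set.
        have := (hs.arc_iff o (w o)).2 ⟨rfl, hwo⟩
        rw [hfree o ho] at this
        cases this
      · rintro _ rfl _ rfl _ _ _
        rfl
  | trade i rest o htop hfav hcycle =>
    have hi : i ∈ s.order := by simp [htop]
    have hp := hs.point hi hfav
    have hR : ∀ j ∈ (s.point i (some o)).cycle i, j ∈ (s.point i (some o)).order :=
      fun j hj => hp.toConsistent.cycle_subset_order hj
    refine ⟨hp.toConsistent.remove hw hR (hp.toConsistent.newSharers_eq hw i), fun j a h => ?_, ?_⟩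
    · obtain ⟨-, h2, h3⟩ := agentArc_remove (s := s.point i (some o))
        (new := (s.point i (some o)).newSharers E ((s.point i (some o)).cycle i)) h
      exact (hp.arc_favorite j a h3).remove h2
    · refine hp.toConsistent.hasRanking_remove
        (new := (s.point i (some o)).newSharers E ((s.point i (some o)).cycle i)) hw hR
        hp.hasRanking ?_ ?_ ?_
      · intro j hj
        obtain ⟨k, -, a, ha, -⟩ := hcycle.exists_next hj
        rw [ha]
        exact hp.arc_favorite j a ha
      · intro j hj a ha hwa
        exact Relation.TransGen.tail hj (hp.next_iff.2 ⟨a, ha, rfl, hwa⟩)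
      · intro j hj j' hj' a ha ha'
        obtain ⟨k, -, hjk⟩ := hcycle.exists_next hj
        refine hcycle.injOn hj hj' hjk ?_
        obtain ⟨b, hb, hbk⟩ := hjk
        obtain rfl : a = b := Option.some_injective _ (ha.symm.trans hb)
        exact ⟨a, ha', hbk⟩
  | request i rest o j htop hfav harc hcycle =>
    have hi : i ∈ s.order := by simp [htop]
    have hp := hs.point hi hfav
    have hj : j ∈ (s.point i (some o)).order := ((hs.arc_iff o j).1 harc).2
    refine ⟨hp.toConsistent.moveToTop hj, hp.arc_favorite, ?_⟩
    simp only [mem_order_moveToTop hj]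
    exact hp.hasRanking

theorem ranked_init (hw : ∀ o, E.owners o = {w o}) (hL : IsAgentOrder L) :
    (init E L).Ranked E w where
  toConsistent := consistent_init hw
  arc_favorite _ _ h := by cases h
  hasRanking := by
    have : {i | i ∉ (init E L).order} = ∅ := Set.eq_empty_of_forall_notMem fun i hi => hi (hL.2 i)
    rw [this]
    exact E.hasRanking_empty _

/-! ### Every ranked allocation is an outcome of the algorithm. -/

/-- Besides consistency: the run has followed `μ`, and the current order is sorted by `r`. -/
structure Follows (w : O → I) (μ : I → Option O) (r : I → ℕ) (s : YState I O) : Prop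
    extends s.Consistent w where
  assigned_eq : ∀ i, i ∉ s.order → s.assigned i = μ i
  arc_eq : ∀ i o, s.agentArc i = some o → μ i = some o
  sorted : s.order.Pairwise fun a b => r a ≤ r b

variable {μ : I → Option O} {r : I → ℕ}

theorem Follows.point (hs : s.Follows w μ r) {i : I} (hi : i ∈ s.order) :
    (s.point i (μ i)).Follows w μ r where
  toConsistent := hs.toConsistent.point hi _
  assigned_eq := hs.assigned_eq
  arc_eq j o h := by
    by_cases hji : j = i
    · subst hji
      rwa [agentArc_point_self] at h
    · exact hs.arc_eq j o (agentArc_point_of_ne hji _ ▸ h)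
  sorted := hs.sorted

theorem Follows.remove (hw : ∀ o, E.owners o = {w o}) (hs : s.Follows w μ r) {R : Set I}
    {new : O → Set I} (hR : ∀ i ∈ R, i ∈ s.order) (hnew : ∀ o, new o = ∅)
    (harc : ∀ i ∈ R, s.agentArc i = μ i) :
    ((s.remove R new).redirect E L).Follows w μ r where
  toConsistent := hs.toConsistent.remove hw hR hnew
  assigned_eq i hi := by
    change (s.remove R new).assigned i = μ i
    by_cases hiR : i ∈ R
    · rw [assigned_remove_of_mem hiR, harc i hiR]
    · rw [assigned_remove_of_notMem hiR]
      exact hs.assigned_eq i fun h => hi ((mem_order_remove (new := new)).2 ⟨h, hiR⟩)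
  arc_eq i o h := hs.arc_eq i o (agentArc_remove (s := s) (new := new) h).2.2
  sorted := by
    classical
    exact hs.sorted.filter _

/-- The top agent has minimal rank among those remaining, so all that she envies in `μ` has left
with agents of smaller rank. -/
theorem Follows.isFavorite (hs : s.Follows w μ r) (hr : E.IsRanking μ Set.univ r) {i : I}
    {rest : List I} (htop : s.order = i :: rest) : s.IsFavorite E i (μ i) := by
  have hi : i ∈ s.order := by simp [htop]
  have hsort := hs.sorted
  rw [htop, List.pairwise_cons] at hsort
  refine ⟨fun o ho => (hs.mem_objects o).2 fun j hj hjo => hj ?_, fun b hb => ?_⟩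
  · rw [hs.assigned_eq j hj] at hjo
    exact hr.isAllocation i j o ho hjo ▸ hi
  · refine E.weaklyPrefers_of_not_prefers fun hlt => ?_
    obtain ⟨o, rfl, j, -, hj, hji⟩ := hr.better_lt i trivial b hlt
    have hjout : j ∉ s.order := by
      rw [htop, List.mem_cons]
      rintro (rfl | h)
      · exact hji.false
      · exact absurd (hsort.1 j h) (by omega)
    exact (hs.mem_objects o).1 (hb o rfl) j hjout ((hs.assigned_eq j hjout).trans hj)

/-- The number of remaining agents, then the number of agents from whom the top is not reached. -/
noncomputable def potential (s : YState I O) : ℕ ×ₗ ℕ :=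
  toLex ({i | i ∈ s.order}.ncard, (s.reachTop)ᶜ.ncard)

/-- Only the first component of `n` matters, so `n` may come from the state before the top agent
pointed. -/
theorem potential_remove_lt [Finite I] {R : Set I} {new : O → Set I} {n : ℕ × ℕ} {i : I}
    (hi : i ∈ s.order) (hiR : i ∈ R) (hn : n.1 = {i | i ∈ s.order}.ncard) :
    ((s.remove R new).redirect E L).potential < toLex n := by
  refine Prod.Lex.toLex_lt_toLex.2 (Or.inl ?_)
  rw [hn]
  refine Set.ncard_lt_ncard ⟨fun j hj => ((mem_order_remove (new := new)).1 hj).1,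
    fun h => ?_⟩
  exact ((mem_order_remove (new := new)).1 (h hi)).2 hiR

theorem Follows.exists_step [Finite I] (hw : ∀ o, E.owners o = {w o})
    (hr : E.IsRanking μ Set.univ r) (hs : s.Follows w μ r) (hne : s.order ≠ []) :
    ∃ t, Step E L s t ∧ t.Follows w μ r ∧ t.potential < s.potential := by
  obtain ⟨i, rest, htop⟩ := List.exists_cons_of_ne_nil hne
  have hi : i ∈ s.order := by simp [htop]
  have hfav := hs.isFavorite hr htop
  have hp := hs.point hi
  by_cases hfree : ∀ o, μ i = some o → s.objectArc o = none
  · refine ⟨_, Step.leave s i rest (μ i) htop hfav hfree, hp.remove hw ?_ (fun _ => rfl) ?_,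
      potential_remove_lt hi rfl rfl⟩
    · rintro _ rfl
      exact hi
    · rintro _ rfl
      exact agentArc_point_self s _ _
  push Not at hfree
  obtain ⟨o, ho, harc⟩ := hfree
  obtain ⟨j, hj⟩ := Option.ne_none_iff_exists'.1 harc
  rw [ho] at hp hfav
  by_cases hcycle : (s.point i (some o)).OnCycle i
  · refine ⟨_, Step.trade s i rest o htop hfav hcycle,
      hp.remove hw (fun k hk => hp.toConsistent.cycle_subset_order hk)
        (hp.toConsistent.newSharers_eq hw i) ?_, potential_remove_lt hi hcycle rfl⟩
    intro k hk
    obtain ⟨l, -, a, ha, -⟩ := hcycle.exists_next hk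
    rw [ha, hp.arc_eq k a ha]
  · have hjo := (hs.arc_iff o j).1 hj
    have hjmem : j ∈ (s.point i (some o)).order := hjo.2
    have hji : r j ≤ r i := hr.owner_le i trivial o ho j (by simp [hw, hjo.1])
    have hsort := hs.sorted
    rw [htop, List.pairwise_cons] at hsort
    refine ⟨_, Step.request s i rest o j htop hfav hj hcycle,
      ⟨hp.toConsistent.moveToTop hjmem, fun k hk => ?_, hp.arc_eq, ?_⟩, ?_⟩
    · rw [mem_order_moveToTop hjmem] at hk
      exact hs.assigned_eq k hk
    · classical
      -- The requested owner ranks no higher than the old top `i`, so moving her up keeps the order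
      -- sorted.
      refine List.pairwise_cons.2 ⟨fun k hk => ?_, hs.sorted.filter _⟩
      have hk' : k ∈ s.order := (List.mem_filter.1 hk).1
      rw [htop, List.mem_cons] at hk'
      rcases hk' with rfl | hk'
      · exact hji
      · exact hji.trans (hsort.1 k hk')
    · refine Prod.Lex.toLex_lt_toLex.2 (Or.inr ⟨?_, ?_⟩)
      · simp only [mem_order_moveToTop hjmem]
        rfl
      · have hnext : (s.point i (some o)).Next i j := ⟨o, agentArc_point_self s i _, hj⟩
        -- Pointing destroys no arc: an earlier arc of `i` already led to `μ i`. So whoever reached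
        -- the old top `i` now reaches the new top `j`, and `j` is newly counted, since reaching `i`
        -- would have closed a cycle.
        have hmono : ∀ x y, s.Next x y → (s.point i (some o)).Next x y := by
          rintro x y ⟨a, ha, hay⟩
          refine ⟨a, ?_, hay⟩
          by_cases hxi : x = i
          · subst hxi
            rw [agentArc_point_self, ← ho, hs.arc_eq x a ha]
          · rwa [agentArc_point_of_ne hxi]
        refine Set.ncard_lt_ncard (compl_lt_compl_iff_lt.2 ⟨?_, fun h => ?_⟩)
        · rintro x ⟨i', hi', hx⟩
          obtain rfl : i = i' := by simpa [htop] using hi'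
          exact ⟨j, rfl, (Relation.ReflTransGen.mono hmono _ _ hx).tail hnext⟩
        · obtain ⟨i', hi', hx⟩ := h ⟨j, rfl, .refl⟩
          obtain rfl : i = i' := by simpa [htop] using hi'
          exact hcycle (.head' hnext (Relation.ReflTransGen.mono hmono _ _ hx))

theorem Follows.exists_run [Finite I] (hw : ∀ o, E.owners o = {w o})
    (hr : E.IsRanking μ Set.univ r) (hs : s.Follows w μ r) :
    ∃ t, Relation.ReflTransGen (Step E L) s t ∧ t.order = [] ∧ t.assigned = μ := by
  induction hm : s.potential using WellFoundedLT.induction generalizing s with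
  | ind m ih =>
    by_cases hne : s.order = []
    · exact ⟨s, .refl, hne, funext fun i => hs.assigned_eq i (by simp [hne])⟩
    · obtain ⟨t, hst, ht, hlt⟩ := hs.exists_step (L := L) hw hr hne
      obtain ⟨u, htu, hu⟩ := ih _ (hm ▸ hlt) ht rfl
      exact ⟨u, .head hst htu, hu⟩

theorem follows_init (hw : ∀ o, E.owners o = {w o}) (hL : IsAgentOrder L)
    (hsorted : L.Pairwise fun a b => r a ≤ r b) :
    (init E L).Follows w μ r where
  toConsistent := consistent_init hw
  assigned_eq i hi := absurd (hL.2 i) hi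
  arc_eq _ _ h := by cases h
  sorted := hsorted

end YState

theorem exists_sorted_agentOrder {I : Type*} [Finite I] (r : I → ℕ) :
    ∃ L : List I, IsAgentOrder L ∧ L.Pairwise fun a b => r a ≤ r b := by
  cases nonempty_fintype I
  refine ⟨(Finset.univ.toList : List I).mergeSort fun a b => decide (r a ≤ r b), ⟨?_, ?_⟩, ?_⟩
  · exact (List.mergeSort_perm _ _).nodup_iff.2 (Finset.nodup_toList _)
  · intro i
    simp
  · have := List.pairwise_mergeSort (le := fun a b => decide (r a ≤ r b))
      (fun a b c => by simpa using le_trans) (fun a b => by simpa using le_total (r a) (r b))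
      (Finset.univ.toList : List I)
    simpa using this

theorem Economy.mem_yrmhOutcomes_iff {I O : Type*} [Finite I] {E : Economy I O} {w : O → I}
    (hw : ∀ o, E.owners o = {w o}) {μ : I → Option O} :
    μ ∈ E.yrmhOutcomes ↔ E.HasRanking μ Set.univ := by
  constructor
  · rintro ⟨L, hL, s, hrun, hs, rfl⟩
    have : s.Ranked E w := by
      clear hs
      induction hrun with
      | refl => exact YState.ranked_init hw hL
      | tail _ hst ih => exact ih.step hw hst
    simpa [hs] using this.hasRanking
  · rintro ⟨r, hr⟩
    obtain ⟨L, hL, hsorted⟩ := exists_sorted_agentOrder r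
    exact ⟨L, hL, (YState.follows_init (μ := μ) hw hL hsorted).exists_run hw hr⟩

end ComplexEndowments

theorem proposition3 {I O : Type*} [Finite I] [Finite O]
    (E : ComplexEndowments.Economy I O) (hE : E.IsPrivateOwnership) :
    E.yrmhOutcomes = E.rectifiedCore ∧
      E.rectifiedCore = E.refinedExclusionCore ∧
      E.refinedExclusionCore = E.exclusionCore ∧
      (E.strongCore.Nonempty → E.exclusionCore = E.strongCore) := by
  obtain ⟨w, hw⟩ := hE.exists_owner
  have hY : E.yrmhOutcomes = {μ | E.HasRanking μ Set.univ} :=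
    Set.ext fun μ => ComplexEndowments.Economy.mem_yrmhOutcomes_iff hw
  have hR : E.rectifiedCore = {μ | E.HasRanking μ Set.univ} :=
    Set.Subset.antisymm
      (fun μ hμ => ComplexEndowments.Economy.hasRanking_of_mem_core hw (Or.inr hμ))
      (fun μ ⟨r, hr⟩ => hr.mem_rectifiedCore hw)
  have hX : E.exclusionCore = {μ | E.HasRanking μ Set.univ} :=
    Set.Subset.antisymm
      (fun μ hμ => ComplexEndowments.Economy.hasRanking_of_mem_core hw (Or.inl hμ))
      (fun μ ⟨r, hr⟩ => hr.mem_exclusionCore hw)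
  have hF : E.refinedExclusionCore = {μ | E.HasRanking μ Set.univ} :=
    Set.Subset.antisymm
      (ComplexEndowments.Economy.refinedExclusionCore_subset_exclusionCore.trans hX.subset)
      (fun μ ⟨r, hr⟩ => hr.mem_refinedExclusionCore hw)
  refine ⟨hY.trans hR.symm, hR.trans hF.symm, hF.trans hX.symm, fun ⟨ν, hν⟩ => ?_⟩
  -- Given a strong core member `ν`, every ranked allocation equals `ν`; the other inclusion holds
  -- because rectification blocking is a case of weak blocking.
  refine Set.Subset.antisymm (fun μ hμ => ?_) ?_
  · obtain ⟨r, hr⟩ := hX.subset hμ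
    exact hr.eq_of_mem_strongCore hν ▸ hν
  · exact ComplexEndowments.Economy.strongCore_subset_rectifiedCore.trans (hR.trans hX.symm).subset
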